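/- Let $(R,\mathfrak m)$ be a (Noetherian) Cohen–Macaulay local ring of Krull dimension $d\ge 2$ with infinite residue field, and let $I$ be an $\mathfrak m$-primary ideal. Let $H_I(n)=\lambda(R/I^n)$ be the Hilbert–Samuel function of $I$ and let $P_I$ be its Hilbert–Samuel polynomial, i.e. the polynomial with rational coefficients such that $P_I(n)=H_I(n)$ for all sufficiently large $n$. For an ideal $J$ of a ring, let $\widetilde{J}=\bigcup_{n\ge 1}(J^{n+1}:J^n)$ be its Ratliff–Rush closure, and let $\rho(I)=\min\{i\ge 1:\widetilde{I^n}=I^n\text{ for all }n\ge i\}$. An element $x\in J$ is superficial for $J$ if there is a positive integer $c$ with $(J^{n+1}:x)\cap J^c=J^n$ for all $n\ge c$; a sequence $x_1,\dots,x_s\in I$ is a superficial sequence for $I$ if for each $i$ the image of $x_i$ in $R/(x_1,\dots,x_{i-1})$ is superficial for the image of $I$ there. The Ratliff–Rush filtration of $I$ behaves well modulo $x_1,\dots,x_s$ if, with $R_s=R/(x_1,\dots,x_s)$, the image of $\widetilde{I^n}$ in $R_s$ equals $\widetilde{I^nR_s}$ for all $n\ge 1$. Suppose that the Ratliff–Rush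 filtration of $I$ behaves well modulo some superficial sequence $x_1,\dots,x_{d-2}\in I$ for $I$ (no condition if $d=2$). If $P_I(k)=H_I(k)$ for some integer $k\ge\rho(I)$, then $P_I(n)=H_I(n)$ for all $n\ge k$. -/

import Mathlib

open Polynomial IsLocalRing

noncomputable section

/-- A Noetherian local ring is Cohen-Macaulay if some regular sequence inside its maximal ideal
has length equal to the Krull dimension of the ring (that is, depth equals dimension). -/
class IsCohenMacaulayLocal (R : Type*) [CommRing R] [IsLocalRing R] : Prop where
  exists_regular : ∃ rs : List R, (∀ r ∈ rs, r ∈ maximalIdeal R) ∧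
    RingTheory.Sequence.IsRegular R rs ∧ (rs.length : WithBot ℕ∞) = ringKrullDim R

/-- The Hilbert-Samuel function `H_I(n) = λ(R / I ^ n)`. The length is finite for an ideal primary
to the maximal ideal of a Noetherian local ring. -/
def hilbertSamuelFun {R : Type*} [CommRing R] (I : Ideal R) (n : ℕ) : ℕ :=
  (Module.length R (R ⧸ I ^ n)).toNat

open Classical in
/-- The Hilbert-Samuel polynomial `P_I`: the polynomial that agrees with the Hilbert-Samuel
function at all sufficiently large integers (it is unique if it exists). -/
def hilbertSamuelPoly {R : Type*} [CommRing R] (I : Ideal R) : ℚ[X] :=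
  if h : ∃ P : ℚ[X], ∀ᶠ n : ℕ in Filter.atTop, P.eval (n : ℚ) = (hilbertSamuelFun I n : ℚ)
  then h.choose else 0

/-- The Ratliff-Rush closure, the union of the increasing chain of the ideals
`(I ^ (n + 1) : I ^ n)` for `n ≥ 1`. -/
def ratliffRush {R : Type*} [CommRing R] (I : Ideal R) : Ideal R :=
  ⨆ n : ℕ, (I ^ (n + 2)).colon ((I ^ (n + 1) : Ideal R) : Set R)

theorem mem_ratliffRush {R : Type*} [CommRing R] (I : Ideal R) (r : R) :
    r ∈ ratliffRush I ↔ ∃ n : ℕ, 1 ≤ n ∧ ∀ s ∈ I ^ n, r * s ∈ I ^ (n + 1) := by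
  have hmono : Monotone
      (fun n : ℕ => (I ^ (n + 2)).colon ((I ^ (n + 1) : Ideal R) : Set R)) := by
    refine monotone_nat_of_le_succ fun n r hr => ?_
    rw [Submodule.mem_colon] at hr ⊢
    intro s hs
    have hs' : s ∈ I ^ (n + 1) * I := by rw [← pow_succ]; exact hs
    rw [smul_eq_mul, pow_succ]
    refine Submodule.mul_induction_on hs' (fun a ha b hb => ?_) (fun a b ha hb => ?_)
    · rw [← mul_assoc]
      exact Ideal.mul_mem_mul (hr a ha) hb
    · rw [mul_add]
      exact Ideal.add_mem _ ha hb
  unfold ratliffRush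
  rw [Submodule.mem_iSup_of_directed _ hmono.directed_le]
  simp only [Submodule.mem_colon, smul_eq_mul, SetLike.mem_coe]
  constructor
  · rintro ⟨n, hn⟩
    exact ⟨n + 1, by omega, hn⟩
  · rintro ⟨n, h1, hn⟩
    obtain ⟨m, rfl⟩ := Nat.exists_eq_add_of_le' h1
    exact ⟨m, hn⟩

/-- The stability index `ρ(I)` of the Ratliff-Rush filtration: the least `i ≥ 1` such that
`I ^ n` is Ratliff-Rush closed for all `n ≥ i`. -/
def stabilityIndex {R : Type*} [CommRing R] (I : Ideal R) : ℕ :=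
  sInf {i : ℕ | 1 ≤ i ∧ ∀ n, i ≤ n → ratliffRush (I ^ n) = I ^ n}

/-- `x ∈ I` is superficial for `I`: for some positive integer `c`,
`(I ^ (n + 1) : x) ∩ I ^ c = I ^ n` for all `n ≥ c`. -/
def IsSuperficial {R : Type*} [CommRing R] (I : Ideal R) (x : R) : Prop :=
  x ∈ I ∧ ∃ c : ℕ, 0 < c ∧ ∀ n, c ≤ n → (I ^ (n + 1)).colon {x} ⊓ I ^ c = I ^ n

/-- `x` is a superficial sequence for `I`: each `x i` is, modulo the earlier terms, superficial
for the image of `I`. -/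
def IsSuperficialSeq {R : Type*} [CommRing R] (I : Ideal R) {s : ℕ} (x : Fin s → R) : Prop :=
  ∀ i : Fin s, IsSuperficial
    (I.map (Ideal.Quotient.mk (Ideal.span (x '' {j | j < i}))))
    (Ideal.Quotient.mk (Ideal.span (x '' {j | j < i})) (x i))

/-- The Ratliff-Rush filtration of `I` behaves well modulo the sequence `x`: for every `n ≥ 1`, the
image of the Ratliff-Rush closure of `I ^ n` in `R / (x)` is the Ratliff-Rush closure of the image
of `I ^ n`. -/
def RatliffRushBehavesWell {R : Type*} [CommRing R] (I : Ideal R) {s : ℕ} (x : Fin s → R) :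
    Prop :=
  ∀ n : ℕ, 1 ≤ n →
    (ratliffRush (I ^ n)).map (Ideal.Quotient.mk (Ideal.span (Set.range x))) =
      ratliffRush ((I ^ n).map (Ideal.Quotient.mk (Ideal.span (Set.range x))))

end

/-! Let F(n) be the colength of the Ratliff–Rush closure of I^n; it equals H_I(n) once n ≥ ρ(I). For
superficial x the closures satisfy (F_{n+1} : x) = F_n in every degree, so a difference of F is a
colength modulo x (`SuperficialMod.colength_rrMod_succ`). Good behaviour modulo x_1, …, x_s, s = d -
2, descends to initial segments (`rrMod_bot_sup_eq_descent`), hence Δ^s F is the shifted Hilbert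
function of the Ratliff–Rush filtration of the two-dimensional quotient R/(x_1, …, x_s)
(`fwdDiff_iterate_colength_rrMod`).

In that quotient the second difference never exceeds its eventual value e
(`exists_second_difference_le`), so Δ^d F ≤ e with eventual equality. Thus F is eventually
polynomial and Δ^d (P_I - F) ≥ 0. As P_I - F vanishes eventually, summing back from infinity makes
it monotone up to sign; a zero at k then forces zeros from k on
(`eq_zero_of_fwdDiff_iterate_nonneg`).

Quotients are handled through ideals of R containing K, so everything lives over one ring. -/

/-! ### Regular elements and depth modulo an ideal. -/

/-- Multiplication by `a` is injective on `R / J`. -/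
def RegMod {R : Type*} [CommRing R] (J : Ideal R) (a : R) : Prop :=
  ∀ r, a * r ∈ J → r ∈ J

/-- The local ring `R / J` admits a weakly regular sequence of length `n` in its maximal ideal. -/
def DepthMod {R : Type*} [CommRing R] [IsLocalRing R] : ℕ → Ideal R → Prop
  | 0, _ => True
  | n + 1, J => ∃ a ∈ maximalIdeal R, RegMod J a ∧ DepthMod n (J ⊔ Ideal.span {a})

section
variable {R : Type*} [CommRing R]

theorem mem_sup_span_singleton {J : Ideal R} {a r : R} :
    r ∈ J ⊔ Ideal.span {a} ↔ ∃ j ∈ J, ∃ s, j + a * s = r := by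
  rw [Submodule.mem_sup]
  constructor
  · rintro ⟨j, hj, z, hz, rfl⟩
    obtain ⟨s, rfl⟩ := Ideal.mem_span_singleton'.1 hz
    exact ⟨j, hj, s, by ring⟩
  · rintro ⟨j, hj, s, rfl⟩
    exact ⟨j, hj, a * s, Ideal.mem_span_singleton'.2 ⟨s, by ring⟩, rfl⟩

theorem RegMod.swap {J : Ideal R} {a c : R} (ha : RegMod J a)
    (hc : RegMod (J ⊔ Ideal.span {a}) c) : RegMod (J ⊔ Ideal.span {c}) a := by
  intro r hr
  obtain ⟨j, hj, s, h⟩ := mem_sup_span_singleton.1 hr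
  have hs : c * s ∈ J ⊔ Ideal.span {a} :=
    mem_sup_span_singleton.2 ⟨-j, J.neg_mem hj, r, by linear_combination -h⟩
  obtain ⟨j', hj', t, h'⟩ := mem_sup_span_singleton.1 (hc s hs)
  have : r - c * t ∈ J := ha _ (by
    have : a * (r - c * t) = j + c * j' := by linear_combination -h - c * h'
    rw [this]; exact J.add_mem hj (J.mul_mem_left _ hj'))
  exact mem_sup_span_singleton.2 ⟨_, this, t, by ring⟩

theorem RegMod.pow {J : Ideal R} {a : R} (ha : RegMod J a) (n : ℕ) : RegMod J (a ^ n) := by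
  induction n with
  | zero => intro r hr; simpa using hr
  | succ n ih => intro r hr; exact ih _ (ha _ (by rwa [pow_succ', mul_assoc] at hr))

variable [IsLocalRing R]

theorem RegMod.exists_mul_notMem {J : Ideal R} {a : R} (ham : a ∈ maximalIdeal R)
    (ha : RegMod J a) {u : R} (hu : u ∉ J) : ∃ y ∈ maximalIdeal R, y * u ∉ J :=
  ⟨a, ham, fun h => hu (ha u h)⟩

/-- Being of depth at least one modulo `J ⊔ (a)` does not depend on the choice of the
`J`-regular element `a`. -/
theorem RegMod.exists_mul_notMem_exchange {J : Ideal R} {a b : R} (ham : a ∈ maximalIdeal R) (ha : RegMod J a) (hb : RegMod J b)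
    (hs : ∀ u, u ∉ J ⊔ Ideal.span {a} → ∃ y ∈ maximalIdeal R, y * u ∉ J ⊔ Ideal.span {a})
    {u : R} (hu : u ∉ J ⊔ Ideal.span {b}) :
    ∃ y ∈ maximalIdeal R, y * u ∉ J ⊔ Ideal.span {b} := by
  by_contra! hcon
  -- Here u is a socle class modulo J + (b). Writing a u ≡ b v transfers it to a socle class v
  -- modulo J + (a), which must vanish; cancelling a then kills u.
  obtain ⟨j, hj, v, hv⟩ := mem_sup_span_singleton.1 (hcon a ham)
  have hvn : v ∈ J ⊔ Ideal.span {a} := by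
    by_contra hvn
    obtain ⟨y, hy, hyv⟩ := hs v hvn
    obtain ⟨j', hj', w, hw⟩ := mem_sup_span_singleton.1 (hcon y hy)
    apply hyv
    have : y * v - a * w ∈ J := hb _ (by
      have : b * (y * v - a * w) = a * j' - y * j := by linear_combination y * hv - a * hw
      rw [this]; exact J.sub_mem (J.mul_mem_left _ hj') (J.mul_mem_left _ hj))
    exact mem_sup_span_singleton.2 ⟨_, this, w, by ring⟩
  obtain ⟨j', hj', w, hw⟩ := mem_sup_span_singleton.1 hvn
  apply hu
  have : u - b * w ∈ J := ha _ (by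
    have : a * (u - b * w) = j + b * j' := by linear_combination -hv - b * hw
    rw [this]; exact J.add_mem hj (J.mul_mem_left _ hj'))
  exact mem_sup_span_singleton.2 ⟨_, this, w, by ring⟩

variable [IsNoetherianRing R]

/-- Prime avoidance over the associated primes of all the R / J i at once: the hypothesis says that
the maximal ideal is not one of them. -/
theorem exists_regMod_of_forall {ι : Type*} [Finite ι] (J : ι → Ideal R)
    (hs : ∀ i u, u ∉ J i → ∃ y ∈ maximalIdeal R, y * u ∉ J i) :
    ∃ c ∈ maximalIdeal R, ∀ i, RegMod (J i) c := by
  classical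
  cases nonempty_fintype ι
  have hfin : (⋃ i, associatedPrimes R (R ⧸ J i)).Finite :=
    Set.finite_iUnion fun i => associatedPrimes.finite R (R ⧸ J i)
  by_contra! hcon
  have hsub : (maximalIdeal R : Set R) ⊆ ⋃ p ∈ (hfin.toFinset : Set (Ideal R)), (p : Set R) := by
    intro c hc
    obtain ⟨i, hi⟩ := hcon c hc
    simp only [RegMod, not_forall] at hi
    obtain ⟨r, hr, hrJ⟩ := hi
    have : c ∈ ⋃ p ∈ associatedPrimes R (R ⧸ J i), (p : Set R) := by
      rw [biUnion_associatedPrimes_eq_zero_divisors]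
      refine ⟨Ideal.Quotient.mk _ r, by rwa [Ne, Ideal.Quotient.eq_zero_iff_mem], ?_⟩
      rw [← Ideal.Quotient.eq_zero_iff_mem, map_mul] at hr
      exact hr
    simp only [Set.mem_iUnion] at this ⊢
    obtain ⟨p, hp, hcp⟩ := this
    exact ⟨p, by simpa using ⟨i, hp⟩, hcp⟩
  rw [Ideal.subset_union_prime (f := fun p : Ideal R => p) ⊤ ⊤] at hsub
  · obtain ⟨p, hp, hle⟩ := hsub
    simp only [Set.Finite.mem_toFinset, Set.mem_iUnion] at hp
    obtain ⟨i, hp⟩ := hp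
    have hpm : p = maximalIdeal R := ((maximalIdeal.isMaximal R).eq_of_le hp.isPrime.ne_top hle).symm
    obtain ⟨-, z, hz⟩ := isAssociatedPrime_iff.1 hp
    obtain ⟨u, rfl⟩ := Ideal.Quotient.mk_surjective z
    have hmem : ∀ y, y ∈ p ↔ y * u ∈ J i := by
      intro y
      rw [hz, Submodule.mem_colon_singleton, ← Ideal.Quotient.eq_zero_iff_mem, map_mul]
      rfl
    obtain ⟨y, hy, hyu⟩ := hs i u fun hu =>
      hp.isPrime.ne_top ((Ideal.eq_top_iff_one p).2 ((hmem 1).2 (by simpa using hu)))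
    exact hyu ((hmem y).1 (hpm ▸ hy))
  · intro p hp _ _
    simp only [Set.Finite.mem_toFinset, Set.mem_iUnion] at hp
    obtain ⟨i, hp⟩ := hp
    exact hp.isPrime

/-- An element c regular modulo both J + (a) and J + (b) links the two: replace a' by c modulo J +
(a), swap, then replace a by b modulo J + (c). -/
theorem DepthMod.exchange (n : ℕ) : ∀ (J : Ideal R) {a b : R}, a ∈ maximalIdeal R →
    b ∈ maximalIdeal R → RegMod J a → RegMod J b → DepthMod n (J ⊔ Ideal.span {a}) →
    DepthMod n (J ⊔ Ideal.span {b}) := by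
  induction n with
  | zero => intros; trivial
  | succ n ih =>
    intro J a b ham hbm ha hb ⟨a', ham', ha', hd⟩
    have hsa : ∀ u, u ∉ J ⊔ Ideal.span {a} →
      ∃ y ∈ maximalIdeal R, y * u ∉ J ⊔ Ideal.span {a} := fun u => ha'.exists_mul_notMem ham'
    obtain ⟨c, hcm, hc⟩ := exists_regMod_of_forall
      ![J ⊔ Ideal.span {a}, J ⊔ Ideal.span {b}] (by
        intro i u
        fin_cases i
        · exact hsa u
        · exact ha.exists_mul_notMem_exchange ham hb hsa)
    have hca : RegMod (J ⊔ Ideal.span {a}) c := hc 0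
    have hcb : RegMod (J ⊔ Ideal.span {b}) c := hc 1
    refine ⟨c, hcm, hcb, ?_⟩
    have h1 := ih _ ham' hcm ha' hca hd
    rw [sup_right_comm] at h1 ⊢
    exact ih _ ham hbm (ha.swap hca) (hb.swap hcb) h1

theorem DepthMod.sup_span {n : ℕ} {J : Ideal R} (h : DepthMod (n + 1) J) {b : R}
    (hbm : b ∈ maximalIdeal R) (hb : RegMod J b) : DepthMod n (J ⊔ Ideal.span {b}) := by
  obtain ⟨a, ham, ha, hd⟩ := h
  exact DepthMod.exchange n J ham hbm ha hb hd

omit [IsNoetherianRing R] in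
theorem depthMod_of_isWeaklyRegular (rs : List R) (hm : ∀ r ∈ rs, r ∈ maximalIdeal R)
    (h : RingTheory.Sequence.IsWeaklyRegular R rs) : DepthMod rs.length (⊥ : Ideal R) := by
  have key : ∀ n i : ℕ, i + n = rs.length → DepthMod n (Ideal.ofList (rs.take i)) := by
    intro n
    induction n with
    | zero => intros; trivial
    | succ n ih =>
      intro i hi
      have hlt : i < rs.length := by omega
      refine ⟨rs[i], hm _ (List.getElem_mem hlt), ?_, ?_⟩
      · intro r hr
        have h1 := h.regular_mod_prev i hlt
        have h2 : (Submodule.Quotient.mk r : R ⧸ (Ideal.ofList (rs.take i) • ⊤ : Ideal R)) = 0 := by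
          apply h1
          simp only [smul_zero]
          rw [← Submodule.Quotient.mk_smul, Submodule.Quotient.mk_eq_zero]
          simpa using hr
        rw [Submodule.Quotient.mk_eq_zero] at h2
        simpa using h2
      · have := ih (i + 1) (by omega)
        rwa [List.take_add_one, List.getElem?_eq_getElem hlt, Ideal.ofList_append, Option.toList_some,
          Ideal.ofList_singleton] at this
  simpa using key rs.length 0 (by simp)

omit [IsLocalRing R] in
omit [IsNoetherianRing R] in
theorem RegMod.ringKrullDim_add_one_le {J : Ideal R} {a : R} (ha : RegMod J a) :
    ringKrullDim (R ⧸ (J ⊔ Ideal.span {a})) + 1 ≤ ringKrullDim (R ⧸ J) := by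
  refine ringKrullDim_succ_le_of_surjective
    (Ideal.Quotient.factor (le_sup_left : J ≤ J ⊔ Ideal.span {a}))
    (Ideal.Quotient.factor_surjective le_sup_left) (r := Ideal.Quotient.mk J a) ?_ ?_
  · rw [mem_nonZeroDivisors_iff_right]
    intro z hz
    obtain ⟨r, rfl⟩ := Ideal.Quotient.mk_surjective z
    rw [← map_mul, Ideal.Quotient.eq_zero_iff_mem] at hz
    exact Ideal.Quotient.eq_zero_iff_mem.2 (ha r (by rwa [mul_comm]))
  · rw [Ideal.Quotient.factor_mk, Ideal.Quotient.eq_zero_iff_mem]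
    exact Ideal.mem_sup_right (Ideal.mem_span_singleton_self a)

end

/-! ### Superficial elements and the Ratliff–Rush filtration modulo an ideal. -/

section
variable {R : Type*} [CommRing R]

/-- `x ∈ I` is superficial for the image of `I` in `R / K`. -/
def SuperficialMod (I K : Ideal R) (x : R) : Prop :=
  x ∈ I ∧ ∃ c : ℕ, ∀ n, c ≤ n → ∀ r ∈ I ^ c ⊔ K, x * r ∈ I ^ (n + 1) ⊔ K → r ∈ I ^ n ⊔ K

/-- `x ∈ I` satisfies `(I ^ (n + 1) : x) = I ^ n` in `R / K` for all large `n`. -/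
def StronglySuperficialMod (I K : Ideal R) (x : R) : Prop :=
  x ∈ I ∧ ∃ c : ℕ, ∀ n, c ≤ n → ∀ r, x * r ∈ I ^ (n + 1) ⊔ K → r ∈ I ^ n ⊔ K

theorem StronglySuperficialMod.superficialMod {I K : Ideal R} {x : R}
    (h : StronglySuperficialMod I K x) : SuperficialMod I K x := by
  obtain ⟨hx, c, hc⟩ := h
  exact ⟨hx, c, fun n hn r _ => hc n hn r⟩

theorem mul_mem_pow_add_sup {I K : Ideal R} {m n : ℕ} {r s : R} (hr : r ∈ I ^ m ⊔ K)
    (hs : s ∈ I ^ n) : r * s ∈ I ^ (m + n) ⊔ K := by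
  obtain ⟨u, hu, v, hv, rfl⟩ := Submodule.mem_sup.1 hr
  rw [add_mul, pow_add]
  exact Ideal.add_mem _ (Ideal.mem_sup_left (Ideal.mul_mem_mul hu hs))
    (Ideal.mem_sup_right (K.mul_mem_right _ hv))

theorem forall_mul_mem_pow_add {I K : Ideal R} {n N : ℕ} {r : R}
    (h : ∀ s ∈ I ^ N, r * s ∈ I ^ (n + N) ⊔ K) (M : ℕ) :
    ∀ s ∈ I ^ (N + M), r * s ∈ I ^ (n + (N + M)) ⊔ K := by
  intro s hs
  rw [pow_add] at hs
  refine Submodule.mul_induction_on hs (fun a ha b hb => ?_) (fun a b ha hb => ?_)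
  · rw [← mul_assoc, ← add_assoc]
    exact mul_mem_pow_add_sup (h a ha) hb
  · rw [mul_add]
    exact Ideal.add_mem _ ha hb

/-- The Ratliff-Rush closure of `I ^ n` modulo `K`: the elements `r` with
`r I ^ N ⊆ I ^ (n + N) + K` for some `N`. -/
def rrMod (I K : Ideal R) (n : ℕ) : Ideal R where
  carrier := {r | ∃ N : ℕ, ∀ s ∈ I ^ N, r * s ∈ I ^ (n + N) ⊔ K}
  zero_mem' := ⟨0, fun s _ => by simp⟩
  add_mem' := by
    rintro a b ⟨N, hN⟩ ⟨M, hM⟩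
    refine ⟨N + M, fun s hs => ?_⟩
    rw [add_mul]
    refine Ideal.add_mem _ (forall_mul_mem_pow_add hN M s hs) ?_
    have := forall_mul_mem_pow_add hM N
    rw [add_comm M N] at this
    exact this s hs
  smul_mem' := by
    rintro a b ⟨N, hN⟩
    refine ⟨N, fun s hs => ?_⟩
    rw [smul_eq_mul, mul_assoc]
    exact Ideal.mul_mem_left _ _ (hN s hs)

theorem mem_rrMod {I K : Ideal R} {n : ℕ} {r : R} :
    r ∈ rrMod I K n ↔ ∃ N : ℕ, ∀ s ∈ I ^ N, r * s ∈ I ^ (n + N) ⊔ K := Iff.rfl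

theorem mem_rrMod_of_le {I K : Ideal R} {n N : ℕ} {r : R}
    (h : ∀ s ∈ I ^ N, r * s ∈ I ^ (n + N) ⊔ K) {M : ℕ} (hM : N ≤ M) :
    ∀ s ∈ I ^ M, r * s ∈ I ^ (n + M) ⊔ K := by
  obtain ⟨k, rfl⟩ := Nat.exists_eq_add_of_le hM
  exact forall_mul_mem_pow_add h k

theorem pow_sup_le_rrMod (I K : Ideal R) (n : ℕ) : I ^ n ⊔ K ≤ rrMod I K n := fun r hr =>
  ⟨0, fun s _ => Ideal.mul_mem_right _ _ (by simpa using hr)⟩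

theorem rrMod_zero (I K : Ideal R) : rrMod I K 0 = ⊤ :=
  top_le_iff.1 (by simpa using pow_sup_le_rrMod I K 0)

theorem rrMod_mono {I K L : Ideal R} (h : K ≤ L) (n : ℕ) : rrMod I K n ≤ rrMod I L n :=
  fun _ ⟨N, hN⟩ => ⟨N, fun s hs => sup_le_sup_left h _ (hN s hs)⟩

theorem mul_mem_rrMod_succ {I K : Ideal R} {n : ℕ} {r x : R} (hx : x ∈ I)
    (hr : r ∈ rrMod I K n) : x * r ∈ rrMod I K (n + 1) := by
  obtain ⟨N, hN⟩ := hr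
  refine ⟨N, fun s hs => ?_⟩
  have := mul_mem_pow_add_sup (hN s hs) (show x ∈ I ^ 1 by simpa using hx)
  rw [show n + 1 + N = n + N + 1 by ring, show x * r * s = r * s * x by ring]
  exact this

/-- The Ratliff-Rush filtration satisfies `(F_{n+1} : x) = F_n` for `x` superficial. -/
theorem SuperficialMod.mem_rrMod_of_mul_mem {I K : Ideal R} {x : R} (h : SuperficialMod I K x)
    {n : ℕ} {r : R} (hr : x * r ∈ rrMod I K (n + 1)) : r ∈ rrMod I K n := by
  obtain ⟨hx, c, hc⟩ := h
  obtain ⟨N, hN⟩ := hr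
  refine ⟨c + N, fun s hs => hc _ (by omega) _ ?_ ?_⟩
  · exact Ideal.mem_sup_left (Ideal.mul_mem_left _ _ (Ideal.pow_le_pow_right (by omega) hs))
  · have := mem_rrMod_of_le hN (M := c + N) (by omega) s hs
    rwa [show n + (c + N) + 1 = n + 1 + (c + N) by ring, ← mul_assoc]

/-- If r I^N lies in I^(n+N) + K, so does r x^N, and the factors x cancel one at a time. -/
theorem StronglySuperficialMod.exists_rrMod_eq {I K : Ideal R} {x : R}
    (h : StronglySuperficialMod I K x) : ∃ c, ∀ n, c ≤ n → rrMod I K n = I ^ n ⊔ K := by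
  obtain ⟨hx, c, hc⟩ := h
  refine ⟨c, fun n hn => le_antisymm ?_ (pow_sup_le_rrMod I K n)⟩
  rintro r ⟨N, hN⟩
  have key : ∀ M, r * x ^ M ∈ I ^ (n + M) ⊔ K → r ∈ I ^ n ⊔ K := by
    intro M
    induction M with
    | zero => simp
    | succ M ih =>
      intro hM
      exact ih (hc _ (by omega) _ (by rwa [pow_succ', mul_left_comm] at hM))
  exact key N (hN _ (Ideal.pow_mem_pow hx N))

/-- If the image of the Ratliff-Rush filtration of `I` modulo `K + (x)` is the Ratliff-Rush
filtration, then the same holds modulo `K`. -/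
theorem rrMod_bot_sup_eq_descent {I K : Ideal R} {x : R} (h : SuperficialMod I K x)
    (hL : ∀ n, rrMod I ⊥ n ⊔ (K ⊔ Ideal.span {x}) = rrMod I (K ⊔ Ideal.span {x}) n) (n : ℕ) :
    rrMod I ⊥ n ⊔ K = rrMod I K n := by
  have hle : ∀ n, rrMod I ⊥ n ⊔ K ≤ rrMod I K n := fun n =>
    sup_le (rrMod_mono bot_le n) (le_sup_right.trans (pow_sup_le_rrMod I K n))
  refine le_antisymm (hle n) ?_
  induction n with
  | zero => simp [rrMod_zero]
  | succ n ih =>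
    intro r hr
    have h1 := rrMod_mono (le_sup_left : K ≤ K ⊔ Ideal.span {x}) _ hr
    rw [← hL, ← sup_assoc] at h1
    obtain ⟨g, hg, t, rfl⟩ := mem_sup_span_singleton.1 h1
    -- The colon property puts t one degree lower, where the induction hypothesis lifts it to a
    -- closure in R itself.
    have h2 : x * t ∈ rrMod I K (n + 1) := by
      simpa using Ideal.sub_mem _ hr (hle _ hg)
    refine Ideal.add_mem _ hg ?_
    obtain ⟨f, hf, k, hk, rfl⟩ := Submodule.mem_sup.1 (ih (h.mem_rrMod_of_mul_mem h2))
    rw [mul_add]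
    exact Ideal.add_mem _ (Ideal.mem_sup_left (mul_mem_rrMod_succ h.1 hf))
      (Ideal.mem_sup_right (K.mul_mem_left _ hk))

theorem mem_of_forall_mem_pow_sup [IsLocalRing R] [IsNoetherianRing R] {I K : Ideal R}
    (hI : I ≤ maximalIdeal R) {r : R} (h : ∀ n, r ∈ I ^ n ⊔ K) : r ∈ K := by
  have h1 := Ideal.iInf_pow_smul_eq_bot_of_isLocalRing (M := R ⧸ K) (I := I)
    (fun h => (maximalIdeal.isMaximal R).ne_top (top_le_iff.1 (h ▸ hI)))
  rw [← Ideal.Quotient.eq_zero_iff_mem, ← Submodule.mem_bot R, ← h1, Submodule.mem_iInf]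
  intro n
  obtain ⟨u, hu, v, hv, rfl⟩ := Submodule.mem_sup.1 (h n)
  rw [map_add, Ideal.Quotient.eq_zero_iff_mem.2 hv, add_zero]
  have := Submodule.smul_mem_smul hu (Submodule.mem_top : (1 : R ⧸ K) ∈ ⊤)
  rwa [Algebra.smul_def, mul_one] at this

/-- A superficial element is regular in positive depth. -/
theorem SuperficialMod.regMod [IsLocalRing R] [IsNoetherianRing R] {I K : Ideal R} {x : R}
    (h : SuperficialMod I K x) (hI : I.radical = maximalIdeal R) {n : ℕ}
    (hd : DepthMod (n + 1) K) : RegMod K x := by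
  obtain ⟨hx, c, hc⟩ := h
  obtain ⟨y, hy, hyK, -⟩ := hd
  rw [← hI] at hy
  obtain ⟨e, he⟩ := hy
  intro r hr
  refine (hyK.pow e).pow c _ ?_
  -- The factor (y^e)^c moves r into I^c; as x kills it modulo K, superficiality puts it in every
  -- I^n + K, and Krull's intersection theorem applies.
  refine mem_of_forall_mem_pow_sup (I := I) (hI ▸ Ideal.le_radical) fun n => ?_
  have := hc (n + c) (by omega) ((y ^ e) ^ c * r)
    (Ideal.mem_sup_left (Ideal.mul_mem_right _ _ (Ideal.pow_mem_pow he c)))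
    (Ideal.mem_sup_right (by rw [mul_left_comm]; exact K.mul_mem_left _ hr))
  have hle : I ^ (n + c) ⊔ K ≤ I ^ n ⊔ K :=
    sup_le_sup_right (Ideal.pow_le_pow_right (by omega)) K
  exact hle this

end

/-! ### Existence of superficial elements over an infinite residue field. -/

/-- A finitely generated module over a local ring with infinite residue field is not a finite
union of proper submodules. -/
theorem exists_forall_notMem_of_infinite_residueField {A M : Type*} [CommRing A] [IsLocalRing A]
    [Infinite (ResidueField A)] [AddCommGroup M] [Module A M] [Module.Finite A M]
    {ι : Type*} (s : Finset ι) (N : ι → Submodule A M) (hN : ∀ i ∈ s, N i ≠ ⊤) :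
    ∃ x, ∀ i ∈ s, x ∉ N i := by
  classical
  by_contra! hcon
  -- By Nakayama the enlarged submodules remain proper. A finite cover would give one of them finite
  -- index, but the quotient contains a copy of the residue field.
  let N' : ι → Submodule A M := fun i => N i ⊔ maximalIdeal A • ⊤
  have hcov : ⋃ i ∈ s, (N' i : Set M) = Set.univ := by
    refine Set.eq_univ_of_forall fun x => ?_
    obtain ⟨i, hi, hx⟩ := hcon x
    simp only [Set.mem_iUnion]
    exact ⟨i, hi, (le_sup_left : N i ≤ N' i) hx⟩
  obtain ⟨i, hi, hfi⟩ := Submodule.exists_finiteIndex_of_cover hcov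
  have hne : N' i ≠ ⊤ := fun h => hN i hi <| top_le_iff.1 <|
    Submodule.le_of_le_smul_of_le_jacobson_bot Module.Finite.fg_top
      (maximalIdeal_le_jacobson _) h.ge
  obtain ⟨e, he⟩ : ∃ e, e ∉ N' i := by
    by_contra! h
    exact hne (eq_top_iff.2 fun x _ => h x)
  have : Finite (M ⧸ N' i) := AddSubgroup.finite_quotient_of_finiteIndex
  let f : ResidueField A → M ⧸ N' i := fun z => Submodule.Quotient.mk (Quotient.out z • e)
  have hf : Function.Injective f := by
    intro z w hzw
    have h1 : (Quotient.out z - Quotient.out w) • e ∈ N' i := by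
      rw [sub_smul]; exact (Submodule.Quotient.eq _).1 hzw
    have h2 : Quotient.out z - Quotient.out w ∈ maximalIdeal A := by
      by_contra hu
      rw [mem_maximalIdeal, mem_nonunits_iff, not_not] at hu
      obtain ⟨u, hu⟩ := hu
      apply he
      rw [← hu] at h1
      simpa [smul_smul] using (N' i).smul_mem (↑u⁻¹ : A) h1
    rw [← Quotient.out_eq z, ← Quotient.out_eq w]
    exact Ideal.Quotient.eq.2 h2
  exact (Finite.of_injective f hf).not_infinite inferInstance

section
variable {A : Type*} [CommRing A]

/-- The ideal `I S` of the Rees algebra `S` of `I`. -/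
def reesShift (I : Ideal A) : Ideal (reesAlgebra I) where
  carrier := {f | ∀ n, (f : A[X]).coeff n ∈ I ^ (n + 1)}
  zero_mem' := by simp
  add_mem' := fun ha hb n => by
    simpa using Ideal.add_mem _ (ha n) (hb n)
  smul_mem' := fun c f hf n => by
    simp only [smul_eq_mul, MulMemClass.coe_mul, coeff_mul]
    refine Ideal.sum_mem _ fun p hp => ?_
    rw [← Finset.HasAntidiagonal.mem_antidiagonal.1 hp, add_assoc, pow_add]
    exact Ideal.mul_mem_mul (c.2 _) (hf _)

theorem mem_reesShift {I : Ideal A} {f : reesAlgebra I} :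
    f ∈ reesShift I ↔ ∀ n, (f : A[X]).coeff n ∈ I ^ (n + 1) := Iff.rfl

/-- The homogeneous element `y t ^ n` of the Rees algebra. -/
noncomputable def reesMonomial (I : Ideal A) (n : ℕ) : ↥(I ^ n) →ₗ[A] reesAlgebra I :=
  LinearMap.codRestrict (Subalgebra.toSubmodule (reesAlgebra I))
    ((monomial n).comp (I ^ n).subtype) fun y => reesAlgebra.monomial_mem.2 y.2

theorem coe_reesMonomial {I : Ideal A} {n : ℕ} (y : ↥(I ^ n)) :
    (reesMonomial I n y : A[X]) = monomial n (y : A) := rfl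

theorem reesMonomial_mem_pow {I : Ideal A} (n : ℕ) (y : ↥(I ^ n)) :
    reesMonomial I n y ∈ Ideal.span (Set.range (reesMonomial I 1)) ^ n := by
  obtain ⟨y, hy⟩ := y
  induction n generalizing y with
  | zero => simp
  | succ n ih =>
    have hy' := hy
    rw [pow_succ] at hy'
    -- The membership proof is part of the induction statement so that the additive case can form
    -- the sum in the subtype.
    have key : ∃ h, reesMonomial I (n + 1) ⟨y, h⟩ ∈
        Ideal.span (Set.range (reesMonomial I 1)) ^ (n + 1) := by
      refine Submodule.mul_induction_on hy' (fun a ha b hb => ?_) (fun a b ha hb => ?_)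
      · have hb' : b ∈ I ^ 1 := by simpa using hb
        refine ⟨by rw [pow_succ]; exact Ideal.mul_mem_mul ha hb, ?_⟩
        have : reesMonomial I (n + 1) ⟨a * b, by rw [pow_succ]; exact Ideal.mul_mem_mul ha hb⟩ =
            reesMonomial I n ⟨a, ha⟩ * reesMonomial I 1 ⟨b, hb'⟩ := by
          apply Subtype.ext
          simp [coe_reesMonomial, monomial_mul_monomial]
        rw [this, pow_succ]
        exact Ideal.mul_mem_mul (ih a ha) (Ideal.subset_span ⟨_, rfl⟩)
      · obtain ⟨ha, ha'⟩ := ha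
        obtain ⟨hb, hb'⟩ := hb
        refine ⟨Ideal.add_mem _ ha hb, ?_⟩
        have := Ideal.add_mem _ ha' hb'
        rwa [← map_add] at this
    exact key.2

/-- An element `x` of `I` whose leading form in the Rees algebra kills modulo `I S` only elements
annihilated by a power of the irrelevant ideal. -/
theorem exists_irrelevant_pow_mul_mem [IsLocalRing A] [IsNoetherianRing A]
    [Infinite (ResidueField A)] (I : Ideal A) :
    ∃ (x : ↥(I ^ 1)) (c : ℕ), ∀ f, reesMonomial I 1 x * f ∈ reesShift I →
      ∀ g ∈ Ideal.span (Set.range (reesMonomial I 1)) ^ c, g * f ∈ reesShift I := by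
  classical
  -- In a primary decomposition of I S, choose x t outside the radical of every component whose
  -- radical misses part of degree one; the other components contain a power of the irrelevant
  -- ideal.
  obtain ⟨s, hs, hprim⟩ := Submodule.isLasker (reesAlgebra I) (reesAlgebra I) (reesShift I)
  let P := Ideal.span (Set.range (reesMonomial I 1))
  let N : Ideal (reesAlgebra I) → Submodule A ↥(I ^ 1) := fun Q =>
    (Q.radical.restrictScalars A).comap (reesMonomial I 1)
  obtain ⟨x, hx⟩ := exists_forall_notMem_of_infinite_residueField
    (s.filter fun Q => N Q ≠ ⊤) N (by simp)
  have hbad : ∀ Q, ∃ c, N Q = ⊤ → P ^ c ≤ Q := by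
    intro Q
    by_cases hQ : N Q = ⊤
    · have : P ≤ Q.radical := by
        rw [Ideal.span_le]
        rintro _ ⟨y, rfl⟩
        have : y ∈ N Q := hQ ▸ Submodule.mem_top
        exact this
      obtain ⟨c, hc⟩ := Ideal.exists_pow_le_of_le_radical_of_fg this (IsNoetherian.noetherian P)
      exact ⟨c, fun _ => hc⟩
    · exact ⟨0, fun h => absurd h hQ⟩
  choose c hc using hbad
  refine ⟨x, s.sup c, fun f hf g hg => ?_⟩
  rw [← hs, Submodule.mem_finsetInf] at hf ⊢
  intro Q hQ
  by_cases hNQ : N Q = ⊤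
  · exact Ideal.mul_mem_right _ _ (hc Q hNQ (Ideal.pow_le_pow_right (Finset.le_sup hQ) hg))
  · have hxQ : reesMonomial I 1 x ∉ Ideal.radical Q := hx Q (by simp [hQ, hNQ])
    have := (Ideal.isPrimary_iff.1 (hprim hQ)).2 (x := f) (y := reesMonomial I 1 x)
      (by rw [mul_comm]; exact hf Q hQ)
    exact Ideal.mul_mem_left _ _ (this.resolve_right hxQ)

/-- The colon (I S : x t) has finitely many generators, of degree at most D. In degree m ≥ D + c its
elements use only coefficients of degree at least c, and these carry the generators into I S. So x t
is injective on the associated graded ring in high degrees. -/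
theorem exists_mem_pow_succ_of_mul_mem [IsLocalRing A] [IsNoetherianRing A]
    [Infinite (ResidueField A)] (I : Ideal A) :
    ∃ x ∈ I, ∃ m₀ : ℕ, ∀ m, m₀ ≤ m → ∀ r ∈ I ^ m, x * r ∈ I ^ (m + 2) → r ∈ I ^ (m + 1) := by
  classical
  obtain ⟨x, c, hc⟩ := exists_irrelevant_pow_mul_mem I
  obtain ⟨t, ht⟩ := IsNoetherian.noetherian ((reesShift I).colon {reesMonomial I 1 x})
  have htc : ∀ f ∈ t, reesMonomial I 1 x * f ∈ reesShift I := by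
    intro f hf
    have : f ∈ (reesShift I).colon {reesMonomial I 1 x} := ht ▸ Submodule.subset_span hf
    rw [Submodule.mem_colon_singleton, smul_eq_mul] at this
    rwa [mul_comm]
  let D := t.sup fun f => (f : A[X]).natDegree
  refine ⟨x, by simpa using x.2, D + c, fun m hm r hr hxr => ?_⟩
  have key : ∀ f ∈ Submodule.span (reesAlgebra I) (t : Set (reesAlgebra I)),
      ∀ g : reesAlgebra I, ((g * f : reesAlgebra I) : A[X]).coeff m ∈ I ^ (m + 1) := by
    intro f hf
    induction hf using Submodule.span_induction with
    | mem f hf =>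
      intro g
      rw [MulMemClass.coe_mul, coeff_mul]
      refine Ideal.sum_mem _ fun p hp => ?_
      have hpm := Finset.HasAntidiagonal.mem_antidiagonal.1 hp
      by_cases hpD : D < p.2
      · have : (f : A[X]).natDegree ≤ D :=
          Finset.le_sup (f := fun f : reesAlgebra I => (f : A[X]).natDegree) hf
        rw [coeff_eq_zero_of_natDegree_lt (lt_of_le_of_lt this hpD), mul_zero]
        exact Ideal.zero_mem _
      · have h1 := hc f (htc f hf) _ (Ideal.pow_le_pow_right (show c ≤ p.1 by omega)
          (reesMonomial_mem_pow p.1 ⟨_, g.2 p.1⟩))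
        have h2 := h1 m
        rw [MulMemClass.coe_mul, coe_reesMonomial, ← hpm, add_comm p.1 p.2,
          coeff_monomial_mul] at h2
        rwa [← hpm, add_comm p.1 p.2]
    | zero => intro g; simp
    | add a b _ _ ha hb =>
      intro g
      rw [mul_add]
      simpa using Ideal.add_mem _ (ha g) (hb g)
    | smul a f _ hf =>
      intro g
      rw [smul_eq_mul, ← mul_assoc]
      exact hf _
  have hmem : reesMonomial I m ⟨r, hr⟩ ∈ (reesShift I).colon {reesMonomial I 1 x} := by
    rw [Submodule.mem_colon_singleton, smul_eq_mul, mem_reesShift]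
    intro n
    rw [MulMemClass.coe_mul, coe_reesMonomial, coe_reesMonomial, monomial_mul_monomial,
      coeff_monomial]
    split_ifs with h
    · subst h; rwa [mul_comm]
    · exact Ideal.zero_mem _
  rw [← ht] at hmem
  have := key _ hmem 1
  rwa [one_mul, coe_reesMonomial, coeff_monomial_same] at this

theorem exists_superficialMod_bot [IsLocalRing A] [IsNoetherianRing A]
    [Infinite (ResidueField A)] (I : Ideal A) : ∃ x, SuperficialMod I ⊥ x := by
  obtain ⟨x, hx, c, hc⟩ := exists_mem_pow_succ_of_mul_mem I
  refine ⟨x, hx, c, fun n hn r hr hxr => ?_⟩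
  rw [sup_bot_eq] at *
  -- Starting from I^c, r climbs one power at a time.
  induction n, hn using Nat.le_induction with
  | base => exact hr
  | succ n hn ih => exact hc n hn r (ih (Ideal.pow_le_pow_right (by omega) hxr)) hxr

/-- By the Artin-Rees lemma. -/
theorem SuperficialMod.stronglySuperficialMod_bot [IsNoetherianRing A] {I : Ideal A} {x : A}
    (h : SuperficialMod I ⊥ x) (hreg : RegMod ⊥ x) : StronglySuperficialMod I ⊥ x := by
  obtain ⟨hx, c, hc⟩ := h
  -- Artin–Rees gives x r ∈ x I^(n+1-k); cancelling x places r in I^c, where superficiality applies.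
  obtain ⟨k, hk⟩ := Ideal.exists_pow_inf_eq_pow_smul I (M := A) (Ideal.span {x})
  refine ⟨hx, c + k, fun n hn r hr => ?_⟩
  rw [sup_bot_eq] at hr
  refine hc n (by omega) r ?_ (by rwa [sup_bot_eq])
  rw [sup_bot_eq]
  have h1 : x * r ∈ I ^ (n + 1) • (⊤ : Submodule A A) ⊓ Ideal.span {x} :=
    ⟨by simpa using hr, Ideal.mul_mem_right _ _ (Ideal.mem_span_singleton_self x)⟩
  rw [hk _ (by omega)] at h1
  have h2 : x * r ∈ Ideal.span {x} * I ^ (n + 1 - k) := by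
    rw [mul_comm, ← smul_eq_mul]
    exact Submodule.smul_mono le_rfl inf_le_right h1
  obtain ⟨z, hz, hzr⟩ := Ideal.mem_span_singleton_mul.1 h2
  have : r = z := by
    have := hreg (r - z) (by rw [Ideal.mem_bot, mul_sub, hzr, sub_self])
    rwa [Ideal.mem_bot, sub_eq_zero] at this
  rw [this]
  exact Ideal.pow_le_pow_right (by omega) hz

end

section
variable {R : Type*} [CommRing R]

theorem mk_mem_map_pow_sup_bot {I K : Ideal R} {n : ℕ} {r : R} :
    Ideal.Quotient.mk K r ∈ I.map (Ideal.Quotient.mk K) ^ n ⊔ ⊥ ↔ r ∈ I ^ n ⊔ K := by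
  rw [sup_bot_eq, ← Ideal.map_pow, Ideal.mem_quotient_iff_mem_sup]

theorem superficialMod_of_map {I K : Ideal R} {x : R} (hx : x ∈ I)
    (h : SuperficialMod (I.map (Ideal.Quotient.mk K)) ⊥ (Ideal.Quotient.mk K x)) :
    SuperficialMod I K x := by
  obtain ⟨-, c, hc⟩ := h
  refine ⟨hx, c, fun n hn r hr hxr => mk_mem_map_pow_sup_bot.1
    (hc n hn _ (mk_mem_map_pow_sup_bot.2 hr) ?_)⟩
  rw [← map_mul]
  exact mk_mem_map_pow_sup_bot.2 hxr

theorem stronglySuperficialMod_of_map {I K : Ideal R} {x : R} (hx : x ∈ I)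
    (h : StronglySuperficialMod (I.map (Ideal.Quotient.mk K)) ⊥ (Ideal.Quotient.mk K x)) :
    StronglySuperficialMod I K x := by
  obtain ⟨-, c, hc⟩ := h
  refine ⟨hx, c, fun n hn r hxr => mk_mem_map_pow_sup_bot.1 (hc n hn _ ?_)⟩
  rw [← map_mul]
  exact mk_mem_map_pow_sup_bot.2 hxr

/-- R / K is again local with infinite residue field, so a superficial element exists there and
lifts to I; positive depth makes it regular, and Artin–Rees strengthens it. -/
theorem exists_stronglySuperficialMod [IsLocalRing R] [IsNoetherianRing R]
    [Infinite (ResidueField R)] {I K : Ideal R} (hI : I.radical = maximalIdeal R)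
    (hK : K ≤ maximalIdeal R) {n : ℕ} (hd : DepthMod (n + 1) K) :
    ∃ x, StronglySuperficialMod I K x ∧ RegMod K x := by
  have : Nontrivial (R ⧸ K) := Ideal.Quotient.nontrivial_iff.2 fun h =>
    (maximalIdeal.isMaximal R).ne_top (top_le_iff.1 (h ▸ hK))
  have : IsLocalRing (R ⧸ K) := .of_surjective' _ Ideal.Quotient.mk_surjective
  have : IsLocalHom (Ideal.Quotient.mk K) := IsLocalHom.of_surjective _ Ideal.Quotient.mk_surjective
  have : Infinite (ResidueField (R ⧸ K)) :=
    Infinite.of_injective (ResidueField.map (Ideal.Quotient.mk K)) (RingHom.injective _)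
  obtain ⟨y, hy⟩ := exists_superficialMod_bot (I.map (Ideal.Quotient.mk K))
  obtain ⟨x, hx, rfl⟩ := (Ideal.mem_map_iff_of_surjective _ Ideal.Quotient.mk_surjective).1 hy.1
  have hreg := (superficialMod_of_map hx hy).regMod hI hd
  refine ⟨x, stronglySuperficialMod_of_map hx (hy.stronglySuperficialMod_bot ?_), hreg⟩
  intro r hr
  obtain ⟨r, rfl⟩ := Ideal.Quotient.mk_surjective r
  rw [← map_mul, Ideal.mem_bot, Ideal.Quotient.eq_zero_iff_mem] at hr
  exact Ideal.Quotient.eq_zero_iff_mem.2 (hreg r hr)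

end

/-! ### Colengths and the second difference in dimension two. -/

section
variable {R : Type*} [CommRing R]

/-- The length of `R / J` as a natural number. -/
noncomputable def colength (J : Ideal R) : ℕ := (Module.length R (R ⧸ J)).toNat

/-- `R / J` has finite length. -/
def FiniteColength (J : Ideal R) : Prop := Module.length R (R ⧸ J) ≠ ⊤

theorem length_quotient_anti {J L : Ideal R} (h : J ≤ L) :
    Module.length R (R ⧸ L) ≤ Module.length R (R ⧸ J) :=
  Module.length_le_of_surjective (Submodule.factor h) (Submodule.factor_surjective h)

theorem FiniteColength.mono {J L : Ideal R} (hJ : FiniteColength J) (h : J ≤ L) :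
    FiniteColength L := ne_top_of_le_ne_top hJ (length_quotient_anti h)

theorem FiniteColength.colength_le {J L : Ideal R} (hJ : FiniteColength J) (h : J ≤ L) :
    colength L ≤ colength J := ENat.toNat_le_toNat (length_quotient_anti h) hJ

/-- Additivity of length on 0 → R/(J : x) → R/J → R/(J + (x)) → 0, the first map being
multiplication by x. -/
theorem FiniteColength.colength_eq_add {J : Ideal R} (hJ : FiniteColength J) (x : R) :
    colength J = colength (J.colon {x}) + colength (J ⊔ Ideal.span {x}) := by
  have hle : J ≤ J.colon {x} := fun r hr =>
    Submodule.mem_colon_singleton.2 (J.mul_mem_right _ hr)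
  let f : (R ⧸ J.colon {x}) →ₗ[R] R ⧸ J := Submodule.mapQ (J.colon {x}) J (LinearMap.mulRight R x)
    fun r hr => Submodule.mem_colon_singleton.1 hr
  have hfmk (r : R) : f (Submodule.Quotient.mk r) = Submodule.Quotient.mk (r * x) := rfl
  let g : (R ⧸ J) →ₗ[R] R ⧸ (J ⊔ Ideal.span {x}) := Submodule.factor le_sup_left
  have hf : Function.Injective f := by
    rw [injective_iff_map_eq_zero]
    intro z hz
    obtain ⟨r, rfl⟩ := Submodule.Quotient.mk_surjective _ z
    rw [hfmk, Submodule.Quotient.mk_eq_zero] at hz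
    exact (Submodule.Quotient.mk_eq_zero _).2 (Submodule.mem_colon_singleton.2 hz)
  have hfg : Function.Exact f g := by
    intro z
    obtain ⟨r, rfl⟩ := Submodule.Quotient.mk_surjective _ z
    constructor
    · intro hz
      have hz' : r ∈ J ⊔ Ideal.span {x} := (Submodule.Quotient.mk_eq_zero _).1 hz
      obtain ⟨j, hj, s, rfl⟩ := mem_sup_span_singleton.1 hz'
      refine ⟨Submodule.Quotient.mk s, ?_⟩
      rw [hfmk, Submodule.Quotient.eq]
      have : s * x - (j + x * s) = -j := by ring
      simpa [this] using hj
    · rintro ⟨w, hw⟩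
      obtain ⟨s, rfl⟩ := Submodule.Quotient.mk_surjective _ w
      rw [← hw]
      refine (Submodule.Quotient.mk_eq_zero _).2 (Ideal.mem_sup_right ?_)
      exact Ideal.mul_mem_left _ _ (Ideal.mem_span_singleton_self x)
  have h := Module.length_eq_add_of_exact f g hf (Submodule.factor_surjective le_sup_left) hfg
  unfold colength
  rw [h, ENat.toNat_add (hJ.mono hle) (hJ.mono le_sup_left)]

theorem le_of_add_one_le {x : WithBot ℕ∞} {n : ℕ} (h : x + 1 ≤ (n + 1 : ℕ)) : x ≤ n := by
  induction x with
  | bot => exact bot_le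
  | coe x =>
    induction x with
    | top =>
      have h' : (⊤ : ℕ∞) + 1 ≤ ((n + 1 : ℕ) : ℕ∞) := by exact_mod_cast h
      rw [top_add, top_le_iff] at h'
      exact absurd h' (ENat.natCast_ne_top _)
    | coe x => norm_cast at *; omega

theorem finiteColength_of_isArtinianRing {J : Ideal R} [IsNoetherianRing R]
    [IsArtinianRing (R ⧸ J)] : FiniteColength J := by
  have : IsArtinian R (R ⧸ J) :=
    isArtinian_of_surjective_algebraMap (R := R ⧸ J) Ideal.Quotient.mk_surjective
  exact Module.length_ne_top

variable [IsLocalRing R] [IsNoetherianRing R]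

theorem finiteColength_pow {I : Ideal R} (hI : I.radical = maximalIdeal R) (n : ℕ) :
    FiniteColength (I ^ n) := by
  rcases Nat.eq_zero_or_pos n with rfl | hn
  · rw [pow_zero, Ideal.one_eq_top]
    have : Subsingleton (R ⧸ (⊤ : Ideal R)) := Ideal.Quotient.subsingleton_iff.2 rfl
    simp [FiniteColength, Module.length_eq_zero]
  · have : IsArtinianRing (R ⧸ I ^ n) := by
      apply IsLocalRing.quotient_artinian_of_mem_minimalPrimes_of_isLocalRing
      rw [← Ideal.radical_minimalPrimes, Ideal.radical_pow _ hn.ne', hI,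
        Ideal.minimalPrimes_eq_subsingleton_self]
      rfl
    exact finiteColength_of_isArtinianRing

omit [IsLocalRing R] in
theorem finiteColength_of_ringKrullDim_le_zero {J : Ideal R} (h : ringKrullDim (R ⧸ J) ≤ 0) :
    FiniteColength J := by
  have : Ring.KrullDimLE 0 (R ⧸ J) := by
    rw [Ring.krullDimLE_iff]; exact h
  have : IsArtinianRing (R ⧸ J) := IsNoetherianRing.isArtinianRing_of_krullDimLE_zero
  exact finiteColength_of_isArtinianRing

theorem exists_pow_le_of_ringKrullDim_le_zero {J I : Ideal R} (h : ringKrullDim (R ⧸ J) ≤ 0)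
    (hI : I ≤ maximalIdeal R) : ∃ n, I ^ n ≤ J := by
  have hd : Ring.KrullDimLE 0 (R ⧸ J) := by
    rw [Ring.krullDimLE_iff]; exact h
  refine Ideal.exists_pow_le_of_le_radical_of_fg ?_ (IsNoetherian.noetherian I)
  rw [Ideal.radical_eq_sInf]
  refine le_sInf fun p ⟨hJp, hp⟩ => ?_
  have hker : RingHom.ker (Ideal.Quotient.mk J) ≤ p := by rwa [Ideal.mk_ker]
  have h1 := Ideal.map_isPrime_of_surjective (Ideal.Quotient.mk_surjective (I := J)) hker
  have h2 := Ring.krullDimLE_zero_iff.1 hd _ h1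
  have h3 := Ideal.comap_isMaximal_of_surjective _ (Ideal.Quotient.mk_surjective (I := J))
    (K := p.map (Ideal.Quotient.mk J))
  rw [Ideal.comap_map_of_surjective' _ Ideal.Quotient.mk_surjective, sup_eq_left.2 hker] at h3
  rw [eq_maximalIdeal h3]
  exact hI

theorem finiteColength_rrMod {I : Ideal R} (hI : I.radical = maximalIdeal R) (K : Ideal R)
    (n : ℕ) : FiniteColength (rrMod I K n) :=
  (finiteColength_pow hI n).mono (le_sup_left.trans (pow_sup_le_rrMod I K n))

theorem SuperficialMod.colength_rrMod_succ {I K : Ideal R} {x : R} (h : SuperficialMod I K x)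
    (hI : I.radical = maximalIdeal R) (n : ℕ) :
    colength (rrMod I K (n + 1)) =
      colength (rrMod I K n) + colength (rrMod I K (n + 1) ⊔ Ideal.span {x}) := by
  rw [(finiteColength_rrMod hI K (n + 1)).colength_eq_add x]
  congr 2
  ext r
  rw [Submodule.mem_colon_singleton, smul_eq_mul, mul_comm]
  exact ⟨h.mem_rrMod_of_mul_mem, mul_mem_rrMod_succ h.1⟩

/-- In a two-dimensional Cohen-Macaulay quotient `R / K`, the second difference of the Hilbert
function of the Ratliff-Rush filtration is bounded by its eventual value. -/
theorem exists_second_difference_le [Infinite (ResidueField R)] {I K : Ideal R}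
    (hI : I.radical = maximalIdeal R) (hK : K ≤ maximalIdeal R) (hd : DepthMod 2 K)
    (hdim : ringKrullDim (R ⧸ K) ≤ 2) :
    ∃ e : ℕ, (∀ n, colength (rrMod I K (n + 2)) + colength (rrMod I K n) ≤
        2 * colength (rrMod I K (n + 1)) + e) ∧
      ∃ c, ∀ n, c ≤ n → colength (rrMod I K (n + 2)) + colength (rrMod I K n) =
        2 * colength (rrMod I K (n + 1)) + e := by
  have hIm : I ≤ maximalIdeal R := hI ▸ Ideal.le_radical
  obtain ⟨a, ha, hra⟩ := exists_stronglySuperficialMod hI hK hd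
  have ham := hIm ha.1
  have hL : K ⊔ Ideal.span {a} ≤ maximalIdeal R :=
    sup_le hK ((Ideal.span_singleton_le_iff_mem _).2 ham)
  obtain ⟨b, hb, hrb⟩ := exists_stronglySuperficialMod hI hL (hd.sup_span ham hra)
  set L := K ⊔ Ideal.span {a} with hLdef
  set J := L ⊔ Ideal.span {b} with hJdef
  have hJ : ringKrullDim (R ⧸ J) ≤ 0 := by
    have h1 := hra.ringKrullDim_add_one_le
    have h2 := hrb.ringKrullDim_add_one_le
    refine le_of_add_one_le (le_of_add_one_le (n := 1) ?_)
    exact (add_le_add_left h2 1).trans (h1.trans hdim)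
  have hJfin := finiteColength_of_ringKrullDim_le_zero hJ
  obtain ⟨N, hN⟩ := exists_pow_le_of_ringKrullDim_le_zero hJ hIm
  -- G is the image of the filtration modulo a, not the Ratliff–Rush filtration there. Only G n ⊆ (G
  -- (n+1) : b) holds in all degrees, whence an inequality with constant λ(R/J).
  let G : ℕ → Ideal R := fun n => rrMod I K n ⊔ Ideal.span {a}
  have hKG : ∀ n, L ≤ G n := fun n =>
    sup_le_sup_right (le_sup_right.trans (pow_sup_le_rrMod I K n)) _
  have hG : ∀ n, colength (rrMod I K (n + 1)) = colength (rrMod I K n) + colength (G (n + 1)) :=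
    ha.superficialMod.colength_rrMod_succ hI
  have hGfin : ∀ n, FiniteColength (G n) := fun n => (finiteColength_rrMod hI K n).mono le_sup_left
  have hcol : ∀ n, G n ≤ (G (n + 1)).colon {b} := by
    intro n r hr
    rw [Submodule.mem_colon_singleton, smul_eq_mul, mul_comm]
    obtain ⟨j, hj, s, rfl⟩ := mem_sup_span_singleton.1 hr
    exact mem_sup_span_singleton.2 ⟨b * j, mul_mem_rrMod_succ hb.1 hj, b * s, by ring⟩
  have hsum : ∀ n, J ≤ G n ⊔ Ideal.span {b} := fun n => sup_le_sup_right (hKG n) _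
  refine ⟨colength J, fun n => ?_, ?_⟩
  · have h1 := (hGfin (n + 2)).colength_eq_add b
    have h2 := (hGfin (n + 1)).colength_le (hcol (n + 1))
    have h3 := hJfin.colength_le (hsum (n + 2))
    have h4 := hG n
    have h5 := hG (n + 1)
    simp only [add_assoc, Nat.reduceAdd] at *
    omega
  · obtain ⟨c₁, hc₁⟩ := ha.exists_rrMod_eq
    obtain ⟨-, c₂, hc₂⟩ := hb
    -- Past c₁, G is I-adic modulo L; past c₂, the colon by b is exact; past N, powers of I lie in
    -- J. Both inequalities then become equalities.
    refine ⟨c₁ + c₂ + N, fun n hn => ?_⟩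
    have hGn : ∀ m, c₁ ≤ m → G m = I ^ m ⊔ L := fun m hm => by
      simp only [G, hc₁ m hm, hLdef, sup_assoc]
    have h1 := (hGfin (n + 2)).colength_eq_add b
    have h2 : (G (n + 2)).colon {b} = G (n + 1) := by
      refine le_antisymm (fun r hr => ?_) (hcol (n + 1))
      rw [Submodule.mem_colon_singleton, smul_eq_mul, mul_comm, hGn _ (by omega)] at hr
      rw [hGn _ (by omega)]
      exact hc₂ (n + 1) (by omega) r hr
    have h3 : G (n + 2) ⊔ Ideal.span {b} = J := by
      refine le_antisymm (sup_le ?_ le_sup_right) (hsum _)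
      rw [hGn _ (by omega)]
      exact sup_le ((Ideal.pow_le_pow_right (by omega)).trans hN) le_sup_left
    rw [h2, h3] at h1
    have h4 := hG n
    have h5 := hG (n + 1)
    simp only [add_assoc, Nat.reduceAdd] at *
    omega

end

/-! ### Finite differences and eventually polynomial functions. -/

section
open Filter

theorem fwdDiff_iterate_eventually_eq {f g : ℕ → ℚ} (h : ∀ᶠ n in atTop, f n = g n) (d : ℕ) :
    ∀ᶠ n in atTop, (fwdDiff 1)^[d] f n = (fwdDiff 1)^[d] g n := by
  induction d with
  | zero => exact h
  | succ d ih =>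
    simp only [Function.iterate_succ_apply']
    filter_upwards [ih, (tendsto_add_atTop_nat 1).eventually ih] with n h1 h2
    simp only [fwdDiff, h1, h2]

/-- Bernoulli polynomials give antidifferences of monomials: B_{n+1}(1 + X) - B_{n+1}(X) = (n + 1)
X^n. -/
theorem exists_polynomial_comp_sub (Q : ℚ[X]) : ∃ P : ℚ[X], P.comp (1 + X) - P = Q := by
  induction Q using Polynomial.induction_on' with
  | add p q hp hq =>
    obtain ⟨P, rfl⟩ := hp
    obtain ⟨P', rfl⟩ := hq
    exact ⟨P + P', by rw [add_comp]; ring⟩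
  | monomial n a =>
    refine ⟨C (a / (n + 1)) * Polynomial.bernoulli (n + 1), ?_⟩
    rw [mul_comp, C_comp, Polynomial.bernoulli_comp_one_add_X, mul_add, add_sub_cancel_left,
      nsmul_eq_mul, ← mul_assoc, ← C_eq_natCast, ← C_mul, ← C_mul_X_pow_eq_monomial]
    have : (n : ℚ) + 1 ≠ 0 := by positivity
    congr 2
    push_cast
    field_simp

/-- A function one of whose iterated differences is eventually polynomial is eventually
polynomial. -/
theorem exists_polynomial_of_fwdDiff_iterate (d : ℕ) : ∀ (f : ℕ → ℚ) (Q : ℚ[X]),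
    (∀ᶠ n : ℕ in atTop, (fwdDiff 1)^[d] f n = Q.eval (n : ℚ)) →
      ∃ P : ℚ[X], ∀ᶠ n : ℕ in atTop, P.eval (n : ℚ) = f n := by
  induction d with
  | zero => exact fun f Q h => ⟨Q, h.mono fun n hn => hn.symm⟩
  | succ d ih =>
    intro f Q h
    simp only [Function.iterate_succ_apply] at h
    obtain ⟨Q', hQ'⟩ := ih _ Q h
    obtain ⟨P, rfl⟩ := exists_polynomial_comp_sub Q'
    obtain ⟨c, hc⟩ := eventually_atTop.1 hQ'
    refine ⟨P + C (f c - P.eval (c : ℚ)), eventually_atTop.2 ⟨c, fun n hn => ?_⟩⟩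
    induction n, hn using Nat.le_induction with
    | base => simp
    | succ n hn ihn =>
      have := hc n hn
      simp only [eval_sub, eval_comp, eval_add, eval_one, eval_X, eval_C, fwdDiff] at *
      rw [Nat.cast_succ, add_comm (n : ℚ) 1]
      linarith

theorem exists_polynomial_fwdDiff_iterate (P : ℚ[X]) (d : ℕ) :
    ∃ Q : ℚ[X], ∀ n : ℕ, (fwdDiff 1)^[d] (fun n : ℕ => P.eval (n : ℚ)) n = Q.eval (n : ℚ) := by
  induction d with
  | zero => exact ⟨P, fun n => rfl⟩
  | succ d ih =>
    obtain ⟨Q, hQ⟩ := ih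
    refine ⟨Q.comp (X + 1) - Q, fun n => ?_⟩
    rw [Function.iterate_succ_apply', fwdDiff, hQ, hQ]
    simp

theorem eq_of_eventually_eval_eq {P : ℚ[X]} {e : ℚ} (h : ∀ᶠ n : ℕ in atTop, P.eval (n : ℚ) = e)
    (n : ℕ) : P.eval (n : ℚ) = e := by
  obtain ⟨c, hc⟩ := eventually_atTop.1 h
  have : P - C e = 0 := by
    refine eq_zero_of_infinite_isRoot _ (Set.infinite_of_injective_forall_mem
      (f := fun k : ℕ => ((c + k : ℕ) : ℚ)) (fun a b hab => ?_) fun k => ?_)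
    · simpa using hab
    · rw [Set.mem_ofPred_eq, IsRoot.def, eval_sub, eval_C, hc (c + k) (by omega), sub_self]
  rw [sub_eq_zero.1 this, eval_C]

/-- A nondecreasing function that is eventually zero is nonpositive, so each summation back from
infinity flips the sign. -/
theorem neg_one_pow_mul_nonneg_of_fwdDiff_iterate_nonneg (d : ℕ) : ∀ f : ℕ → ℚ,
    (∀ n, 0 ≤ (fwdDiff 1)^[d] f n) → (∀ᶠ n in atTop, f n = 0) → ∀ n, 0 ≤ (-1) ^ d * f n := by
  induction d with
  | zero => intro f h _ n; simpa using h n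
  | succ d ih =>
    intro f h h0 n
    simp only [Function.iterate_succ_apply] at h
    have hd := ih (fwdDiff 1 f) h (by
      filter_upwards [h0, (tendsto_add_atTop_nat 1).eventually h0] with n h1 h2
      simp [fwdDiff, h1, h2])
    have hmono : Monotone fun n => (-1) ^ d * f n := monotone_nat_of_le_succ fun n => by
      have := hd n
      rw [fwdDiff, mul_sub] at this
      linarith
    obtain ⟨c, hc⟩ := eventually_atTop.1 h0
    have h1 := hmono (le_max_left n c)
    simp only [hc _ (le_max_right n c)] at h1
    rw [pow_succ]
    linarith

/-- The sign rule for Δf makes (-1)^d f monotone; beyond k it is squeezed between its zero at k and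
its eventual zeros. -/
theorem eq_zero_of_fwdDiff_iterate_nonneg {d : ℕ} {f : ℕ → ℚ}
    (h : ∀ n, 0 ≤ (fwdDiff 1)^[d + 1] f n) (h0 : ∀ᶠ n in atTop, f n = 0) {k : ℕ} (hk : f k = 0)
    {n : ℕ} (hn : k ≤ n) : f n = 0 := by
  have hd := neg_one_pow_mul_nonneg_of_fwdDiff_iterate_nonneg d (fwdDiff 1 f) h (by
    filter_upwards [h0, (tendsto_add_atTop_nat 1).eventually h0] with n h1 h2
    simp [fwdDiff, h1, h2])
  have hmono : Monotone fun n => (-1) ^ d * f n := monotone_nat_of_le_succ fun n => by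
    have := hd n
    rw [fwdDiff, mul_sub] at this
    linarith
  obtain ⟨c, hc⟩ := eventually_atTop.1 h0
  have h1 := hmono (le_max_left n c)
  have h2 := hmono hn
  simp only [hc _ (le_max_right n c), hk] at h1 h2
  have h3 : (-1 : ℚ) ^ d * f n = 0 := by linarith
  exact (mul_eq_zero.1 h3).resolve_left (by simp)

/-- If an iterated difference of `F` is bounded by its eventual constant value, then `F` agrees
with its polynomial from any point of agreement on. -/
theorem eval_eq_of_fwdDiff_iterate_le {d : ℕ} {F : ℕ → ℚ} {P : ℚ[X]} {e : ℚ}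
    (hle : ∀ n, (fwdDiff 1)^[d + 1] F n ≤ e) (heq : ∀ᶠ n in atTop, (fwdDiff 1)^[d + 1] F n = e)
    (hP : ∀ᶠ n : ℕ in atTop, P.eval (n : ℚ) = F n) {k : ℕ} (hk : P.eval (k : ℚ) = F k) {n : ℕ}
    (hn : k ≤ n) : P.eval (n : ℚ) = F n := by
  obtain ⟨Q, hQ⟩ := exists_polynomial_fwdDiff_iterate P (d + 1)
  -- This difference of P is itself polynomial, so being eventually e it is e everywhere.
  have hQe : ∀ n : ℕ, Q.eval (n : ℚ) = e := by
    refine eq_of_eventually_eval_eq ?_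
    filter_upwards [heq, fwdDiff_iterate_eventually_eq hP (d + 1)] with n h1 h2
    rw [← hQ, h2, h1]
  have hsub : ∀ m n, (fwdDiff 1)^[m] (fun n : ℕ => P.eval (n : ℚ) - F n) n =
      (fwdDiff 1)^[m] (fun n : ℕ => P.eval (n : ℚ)) n - (fwdDiff 1)^[m] F n := by
    intro m
    induction m with
    | zero => intro n; rfl
    | succ m ih => intro n; simp only [Function.iterate_succ_apply', fwdDiff, ih]; ring
  refine sub_eq_zero.1 (eq_zero_of_fwdDiff_iterate_nonneg (d := d)
    (f := fun n : ℕ => P.eval (n : ℚ) - F n) (fun n => ?_) ?_ (sub_eq_zero.2 hk) hn)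
  · rw [hsub, hQ, hQe]
    linarith [hle n]
  · exact hP.mono fun n h => sub_eq_zero.2 h

end

/-! ### Iterated differences along the superficial sequence, and conclusion. -/

section
variable {R : Type*} [CommRing R]

/-- The exponents n N are cofinal among all exponents, so testing against powers of I^n or of I
gives the same closure. -/
theorem ratliffRush_pow_eq_rrMod (I : Ideal R) {n : ℕ} (hn : 1 ≤ n) :
    ratliffRush (I ^ n) = rrMod I ⊥ n := by
  ext r
  rw [mem_ratliffRush, mem_rrMod]
  simp only [sup_bot_eq, ← pow_mul]
  constructor
  · rintro ⟨N, -, hN⟩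
    exact ⟨n * N, fun s hs => by simpa [mul_add, add_comm] using hN s hs⟩
  · rintro ⟨N, hN⟩
    refine ⟨N + 1, by omega, fun s hs => ?_⟩
    have := mem_rrMod_of_le (K := ⊥) (by simpa using hN) (M := n * (N + 1)) (by nlinarith) s hs
    rwa [sup_bot_eq, show n + n * (N + 1) = n * (N + 1 + 1) by ring] at this

theorem mk_mem_rrMod_map {I K : Ideal R} {n : ℕ} {r : R} :
    Ideal.Quotient.mk K r ∈ rrMod (I.map (Ideal.Quotient.mk K)) ⊥ n ↔ r ∈ rrMod I K n := by
  rw [mem_rrMod, mem_rrMod]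
  refine exists_congr fun N => ⟨fun h s hs => ?_, fun h s hs => ?_⟩
  · rw [← mk_mem_map_pow_sup_bot, map_mul]
    exact h _ (by rw [← Ideal.map_pow]; exact Ideal.mem_map_of_mem _ hs)
  · rw [← Ideal.map_pow] at hs
    obtain ⟨t, ht, rfl⟩ := (Ideal.mem_map_iff_of_surjective _ Ideal.Quotient.mk_surjective).1 hs
    rw [← map_mul, mk_mem_map_pow_sup_bot]
    exact h t ht

theorem RatliffRushBehavesWell.rrMod_bot_sup_eq {I : Ideal R} {s : ℕ} {x : Fin s → R}
    (h : RatliffRushBehavesWell I x) (n : ℕ) :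
    rrMod I ⊥ n ⊔ Ideal.span (Set.range x) = rrMod I (Ideal.span (Set.range x)) n := by
  rcases Nat.eq_zero_or_pos n with rfl | hn
  · simp [rrMod_zero]
  · have h1 := h n hn
    rw [Ideal.map_pow, ratliffRush_pow_eq_rrMod I hn, ratliffRush_pow_eq_rrMod _ hn] at h1
    ext r
    rw [← mk_mem_rrMod_map, ← h1, Ideal.mem_quotient_iff_mem_sup]

/-- The ideal generated by the first `i` terms of `x`. -/
def initialIdeal {s : ℕ} (x : Fin s → R) (i : ℕ) : Ideal R :=
  Ideal.span (x '' {j | (j : ℕ) < i})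

theorem initialIdeal_zero {s : ℕ} (x : Fin s → R) : initialIdeal x 0 = ⊥ := by
  simp [initialIdeal]

theorem initialIdeal_self {s : ℕ} (x : Fin s → R) :
    initialIdeal x s = Ideal.span (Set.range x) := by
  have : {j : Fin s | (j : ℕ) < s} = Set.univ := Set.eq_univ_of_forall fun j => j.2
  rw [initialIdeal, this, Set.image_univ]

theorem initialIdeal_succ {s : ℕ} (x : Fin s → R) {i : ℕ} (hi : i < s) :
    initialIdeal x (i + 1) = initialIdeal x i ⊔ Ideal.span {x ⟨i, hi⟩} := by
  have : {j : Fin s | (j : ℕ) < i + 1} = {j : Fin s | (j : ℕ) < i} ∪ {⟨i, hi⟩} := by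
    ext j
    simp only [Set.mem_ofPred_eq, Set.mem_union, Set.mem_singleton_iff, Fin.ext_iff]
    omega
  rw [initialIdeal, this, Set.image_union, Set.image_singleton, Ideal.span_union, initialIdeal]

theorem IsSuperficial.superficialMod_bot {I : Ideal R} {x : R} (h : IsSuperficial I x) :
    SuperficialMod I ⊥ x := by
  obtain ⟨hx, c, -, hc⟩ := h
  refine ⟨hx, c, fun n hn r hr hxr => ?_⟩
  rw [sup_bot_eq] at *
  rw [← hc n hn]
  exact ⟨Submodule.mem_colon_singleton.2 (by rwa [smul_eq_mul, mul_comm]), hr⟩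

theorem IsSuperficialSeq.superficialMod {I : Ideal R} {s : ℕ} {x : Fin s → R}
    (h : IsSuperficialSeq I x) (hxI : ∀ i, x i ∈ I) {i : ℕ} (hi : i < s) :
    SuperficialMod I (initialIdeal x i) (x ⟨i, hi⟩) :=
  superficialMod_of_map (hxI _) (h ⟨i, hi⟩).superficialMod_bot

theorem rrMod_bot_sup_initialIdeal {I : Ideal R} {s : ℕ} {x : Fin s → R}
    (hx : ∀ i (hi : i < s), SuperficialMod I (initialIdeal x i) (x ⟨i, hi⟩))
    (hbw : RatliffRushBehavesWell I x) {i : ℕ} (hi : i ≤ s) :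
    ∀ n, rrMod I ⊥ n ⊔ initialIdeal x i = rrMod I (initialIdeal x i) n := by
  induction hi using Nat.decreasingInduction with
  | self => rw [initialIdeal_self]; exact hbw.rrMod_bot_sup_eq
  | of_succ i hi ih =>
    rw [initialIdeal_succ x hi] at ih
    exact rrMod_bot_sup_eq_descent (hx i hi) ih

variable [IsLocalRing R] [IsNoetherianRing R]

/-- Each difference trades one x_i for one passage to a quotient; good behaviour identifies the
image filtration with the Ratliff–Rush filtration there. The forward difference accounts for the
shift by i. -/
theorem fwdDiff_iterate_colength_rrMod {I : Ideal R} (hI : I.radical = maximalIdeal R) {s : ℕ}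
    {x : Fin s → R} (hx : ∀ i (hi : i < s), SuperficialMod I (initialIdeal x i) (x ⟨i, hi⟩))
    (hbw : RatliffRushBehavesWell I x) {i : ℕ} (hi : i ≤ s) (n : ℕ) :
    (fwdDiff 1)^[i] (fun n => (colength (rrMod I ⊥ n) : ℚ)) n =
      colength (rrMod I (initialIdeal x i) (n + i)) := by
  induction i generalizing n with
  | zero => rw [initialIdeal_zero]; rfl
  | succ i ih =>
    have hlt : i < s := hi
    have h1 := (hx i hlt).colength_rrMod_succ hI (n + i)
    have h2 : rrMod I (initialIdeal x i) (n + i + 1) ⊔ Ideal.span {x ⟨i, hlt⟩} =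
        rrMod I (initialIdeal x (i + 1)) (n + i + 1) := by
      rw [← rrMod_bot_sup_initialIdeal hx hbw hlt.le, ← rrMod_bot_sup_initialIdeal hx hbw hi,
        initialIdeal_succ x hlt, sup_assoc]
    rw [h2] at h1
    rw [Function.iterate_succ_apply', fwdDiff, ih hlt.le, ih hlt.le,
      show n + 1 + i = n + i + 1 by ring, h1, ← add_assoc]
    push_cast
    ring

omit [IsLocalRing R] [IsNoetherianRing R] in
theorem initialIdeal_le {I : Ideal R} {s : ℕ} {x : Fin s → R} (hxI : ∀ i, x i ∈ I) (i : ℕ) :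
    initialIdeal x i ≤ I := by
  rw [initialIdeal, Ideal.span_le]
  rintro _ ⟨j, -, rfl⟩
  exact hxI j

theorem depthMod_initialIdeal {I : Ideal R} (hI : I.radical = maximalIdeal R) {s : ℕ}
    {x : Fin s → R} (hxI : ∀ i, x i ∈ I)
    (hx : ∀ i (hi : i < s), SuperficialMod I (initialIdeal x i) (x ⟨i, hi⟩))
    (hd : DepthMod (s + 2) (⊥ : Ideal R)) (hdim : ringKrullDim R ≤ (s + 2 : ℕ)) {i m : ℕ}
    (hi : i + m = s) : DepthMod (m + 2) (initialIdeal x i) ∧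
      ringKrullDim (R ⧸ initialIdeal x i) ≤ (m + 2 : ℕ) := by
  induction i generalizing m with
  | zero =>
    obtain rfl : m = s := by omega
    rw [initialIdeal_zero]
    exact ⟨hd, (ringKrullDim_quotient_le _).trans hdim⟩
  | succ i ih =>
    have hlt : i < s := by omega
    obtain ⟨h1, h2⟩ := ih (m := m + 1) (by omega)
    have hreg := (hx i hlt).regMod hI h1
    have hmem : x ⟨i, hlt⟩ ∈ maximalIdeal R := hI ▸ Ideal.le_radical (hxI _)
    rw [initialIdeal_succ x hlt]
    rw [show m + 1 + 2 = m + 2 + 1 by ring] at h1 h2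
    exact ⟨h1.sup_span hmem hreg, le_of_add_one_le (hreg.ringKrullDim_add_one_le.trans h2)⟩

omit [IsNoetherianRing R] in
theorem IsCohenMacaulayLocal.depthMod [IsCohenMacaulayLocal R] {d : ℕ}
    (hdim : ringKrullDim R = (d : WithBot ℕ∞)) : DepthMod d (⊥ : Ideal R) := by
  obtain ⟨rs, hm, hreg, hlen⟩ := IsCohenMacaulayLocal.exists_regular (R := R)
  have := depthMod_of_isWeaklyRegular rs hm hreg.toIsWeaklyRegular
  rw [hdim] at hlen
  rwa [show rs.length = d by exact_mod_cast hlen] at this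

theorem exists_ratliffRush_pow_eq [Infinite (ResidueField R)] {I : Ideal R}
    (hI : I.radical = maximalIdeal R) {m : ℕ} (hd : DepthMod (m + 1) (⊥ : Ideal R)) :
    ∃ c, 1 ≤ c ∧ ∀ n, c ≤ n → ratliffRush (I ^ n) = I ^ n := by
  obtain ⟨a, ha, -⟩ := exists_stronglySuperficialMod hI bot_le hd
  obtain ⟨c, hc⟩ := ha.exists_rrMod_eq
  refine ⟨c + 1, by omega, fun n hn => ?_⟩
  rw [ratliffRush_pow_eq_rrMod I (by omega), hc n (by omega), sup_bot_eq]

end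

theorem hilbertSamuelPoly_eventually_eq {R : Type*} [CommRing R] {I : Ideal R}
    (h : ∃ P : ℚ[X], ∀ᶠ n : ℕ in Filter.atTop, P.eval (n : ℚ) = (hilbertSamuelFun I n : ℚ)) :
    ∀ᶠ n : ℕ in Filter.atTop,
      (hilbertSamuelPoly I).eval (n : ℚ) = (hilbertSamuelFun I n : ℚ) := by
  rw [hilbertSamuelPoly, dif_pos h]
  exact h.choose_spec

theorem corollary5p7 {R : Type*} [CommRing R] [IsLocalRing R] [IsNoetherianRing R]
    [IsCohenMacaulayLocal R] [Infinite (ResidueField R)]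
    (d : ℕ) (hd : 2 ≤ d) (hdim : ringKrullDim R = (d : WithBot ℕ∞))
    (I : Ideal R) (hI : I.radical = maximalIdeal R)
    (x : Fin (d - 2) → R) (hxI : ∀ i, x i ∈ I) (hx : IsSuperficialSeq I x)
    (hbw : RatliffRushBehavesWell I x)
    (k : ℕ) (hk : stabilityIndex I ≤ k)
    (hPH : (hilbertSamuelPoly I).eval (k : ℚ) = (hilbertSamuelFun I k : ℚ)) :
    ∀ n : ℕ, k ≤ n →
      (hilbertSamuelPoly I).eval (n : ℚ) = (hilbertSamuelFun I n : ℚ) := by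
  generalize hs : d - 2 = s at x hxI hx hbw
  obtain rfl : d = s + 2 := by omega
  have hIm : I ≤ maximalIdeal R := hI ▸ Ideal.le_radical
  have hdepth : DepthMod (s + 2) (⊥ : Ideal R) := IsCohenMacaulayLocal.depthMod hdim
  -- Positive depth makes the set defining ρ(I) nonempty, so its infimum is attained rather than the
  -- default 0.
  obtain ⟨hρ1, hρ⟩ := Nat.sInf_mem (exists_ratliffRush_pow_eq hI hdepth)
  have hsup := fun i hi => hx.superficialMod hxI (i := i) hi
  have hHF : ∀ n, k ≤ n → colength (rrMod I ⊥ n) = hilbertSamuelFun I n := fun n hn => by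
    rw [← ratliffRush_pow_eq_rrMod I (hρ1.trans (hk.trans hn)), hρ n (hk.trans hn)]
    rfl
  obtain ⟨h1, h2⟩ := depthMod_initialIdeal hI hxI hsup hdepth hdim.le (add_zero s)
  obtain ⟨e, hle, c, heq⟩ := exists_second_difference_le hI
    ((initialIdeal_le hxI s).trans hIm) h1 h2
  let F : ℕ → ℚ := fun n => colength (rrMod I ⊥ n)
  have hΔ : ∀ n, (fwdDiff 1)^[s + 1 + 1] F n =
      colength (rrMod I (initialIdeal x s) (n + s + 2)) +
        colength (rrMod I (initialIdeal x s) (n + s)) -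
        2 * colength (rrMod I (initialIdeal x s) (n + s + 1)) := fun n => by
    simp only [Function.iterate_succ_apply', fwdDiff, F,
      fwdDiff_iterate_colength_rrMod hI hsup hbw le_rfl]
    rw [show n + 1 + 1 + s = n + s + 2 by ring, show n + 1 + s = n + s + 1 by ring]
    ring
  have hFle : ∀ n, (fwdDiff 1)^[s + 1 + 1] F n ≤ e := fun n => by
    have : ((_ : ℕ) : ℚ) ≤ (_ : ℕ) := Nat.cast_le.2 (hle (n + s))
    push_cast at this
    rw [hΔ]
    linarith
  have hFeq : ∀ᶠ n in Filter.atTop, (fwdDiff 1)^[s + 1 + 1] F n = e :=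
    Filter.eventually_atTop.2 ⟨c, fun n hn => by
      have : ((_ : ℕ) : ℚ) = (_ : ℕ) := congrArg Nat.cast (heq (n + s) (by omega))
      push_cast at this
      rw [hΔ]
      linarith⟩
  have hev : ∀ᶠ n : ℕ in Filter.atTop, F n = hilbertSamuelFun I n :=
    Filter.eventually_atTop.2 ⟨k, fun n hn => congrArg Nat.cast (hHF n hn)⟩
  -- The Hilbert–Samuel polynomial is not the default 0: F, hence H_I, is eventually polynomial
  -- because Δ^(s+2) F is eventually constant.
  have hP := hilbertSamuelPoly_eventually_eq (I := I) (by
    obtain ⟨P, hP⟩ := exists_polynomial_of_fwdDiff_iterate (s + 1 + 1) F (C (e : ℚ))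
      (hFeq.mono fun n hn => by rw [hn, eval_C])
    exact ⟨P, by filter_upwards [hP, hev] with n h3 h4; rw [h3, h4]⟩)
  intro n hn
  rw [← hHF n hn]
  refine eval_eq_of_fwdDiff_iterate_le hFle hFeq ?_ (k := k) ?_ hn
  · filter_upwards [hP, hev] with n h3 h4
    rw [h3, h4]
  · simp only [F, hHF k le_rfl]
    exact hPH
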